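/- Let $\{X_t\}_{t\in\mathbb Z}$ be a real-valued stationary (not necessarily ergodic) process on a probability space with probability measure $P$; write $X=X_0$ and $X^-=(\ldots,X_{-2},X_{-1})$, and let $P(dx|X^-)$ be the regular conditional distribution of $X$ given $X^-$. Let $\mathcal B_1\subseteq\mathcal B_2\subseteq\cdots$ be finite fields of subsets of $\mathbb R$ such that $\bigcup_k\mathcal B_k$ generates the Borel $\sigma$-field, let $\Xi_k$ be the set of atoms of $\mathcal B_k$, and let $[x]^k\in\Xi_k$ denote the atom containing $x$. Let $(\ell_k)$ and $(J_k)$ be nondecreasing unbounded sequences of positive integers. Put $\tau^k_0=0$ and, for $j\ge1$, $$\tau^k_j=\min\{t>\tau^k_{j-1}:\ ([X_{-\ell_k-t}]^k,\ldots,[X_{-1-t}]^k)=([X_{-\ell_k}]^k,\ldots,[X_{-1}]^k)\}\qquad(\min\emptyset=\infty),$$ and let $\lambda_k=\ell_k+\tau^k_{J_k}$. Let $Q$ be a fixed finite Borel measure on $\mathbb R$ (a default measure), let $k(n)$ be a nondecreasing unbounded sequence of positive integers, and define $$\hat P(dx|X^{-n})=\begin{cases}\dfrac1{J_{k(n)}}\displaystyle\sum_{1\le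 j\le J_{k(n)}}\delta_{X_{-\tau^{k(n)}_j}}(dx)&\text{if }\lambda_{k(n)}\le n,\\ Q(dx)&\text{otherwise.}\end{cases}$$ Suppose that for some numbers $\varepsilon_k>0$ with $\varepsilon_k\to0$, $$n\ \ge\ \ell_{k(n)}+J_{k(n)}\,|\Xi_{k(n)}|^{\ell_{k(n)}}/\varepsilon_{k(n)}\qquad\text{for all sufficiently large }n.$$ Then $P\{\lambda_{k(n)}\le n\}\to1$ as $n\to\infty$, and the estimates $\hat P(dx|X^{-n})$ are weakly consistent: for every set $B\in\bigcup_k\mathcal B_k$, $$\hat P\{X\in B|X^{-n}\}\to P\{X\in B|X^-\}\quad\text{in }L^1(P),$$ and for every bounded continuous function $h:\mathbb R\to\mathbb R$, $$\int h(x)\,\hat P(dx|X^{-n})\to\int h(x)\,P(dx|X^-)\quad\text{in }L^1(P).$$ -/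

import Mathlib

open MeasureTheory ProbabilityTheory Filter Topology
open scoped ENNReal

namespace RecurrenceEstimate

/-- The quantizer `x ↦ [x]` of a finite field `F` of subsets of `ℝ`: it maps `x` to the atom of `F`
that contains `x`, i.e. the intersection of all members of `F` containing `x`. -/
def quantize (F : Set (Set ℝ)) (x : ℝ) : Set ℝ := ⋂₀ {s ∈ F | x ∈ s}

/-- The set `Ξ` of all atoms of the field `F`. -/
def atoms (F : Set (Set ℝ)) : Set (Set ℝ) := Set.range (quantize F)

/-- `([x_{-ℓ-t}], …, [x_{-1-t}]) = ([x_{-ℓ}], …, [x_{-1}])`: the quantized `ℓ`-past of the path `x`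
at time `-t` looks like the quantized `ℓ`-past at time `0`. -/
def SamePast (F : Set (Set ℝ)) (ℓ : ℕ) (x : ℤ → ℝ) (t : ℕ) : Prop :=
  ∀ i ∈ Finset.Icc 1 ℓ, quantize F (x (-(i : ℤ) - (t : ℤ))) = quantize F (x (-(i : ℤ)))

/-- The past recurrence times `τ_0 = 0`, `τ_{j+1} = min {t > τ_j : SamePast t}` of the quantized
`ℓ`-past of the path `x`; the value is `∞` if there is no such `t`. -/
noncomputable def recTime (F : Set (Set ℝ)) (ℓ : ℕ) (x : ℤ → ℝ) : ℕ → ℕ∞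
  | 0 => 0
  | j + 1 => ⨅ t : {t : ℕ // recTime F ℓ x j < (t : ℕ∞) ∧ SamePast F ℓ x t}, ((t : ℕ) : ℕ∞)

/-- The length `λ = ℓ + τ_J` of the data segment that must be inspected to find `J` samples. -/
noncomputable def searchDepth (F : Set (Set ℝ)) (ℓ J : ℕ) (x : ℤ → ℝ) : ℕ∞ :=
  (ℓ : ℕ∞) + recTime F ℓ x J

/-- The empirical distribution `(1/J) ∑_{1 ≤ j ≤ J} δ_{x_{-τ_j}}` of the `J` samples
(only meaningful when `searchDepth F ℓ J x < ∞`). -/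
noncomputable def empirical (F : Set (Set ℝ)) (ℓ J : ℕ) (x : ℤ → ℝ) : Measure ℝ :=
  (J : ℝ≥0∞)⁻¹ • ∑ j ∈ Finset.Icc 1 J, Measure.dirac (x (-((recTime F ℓ x j).toNat : ℤ)))

open Classical in
/-- The truncated estimate: the empirical distribution if the search depth is at most `n`, and the
default measure `Q` otherwise. -/
noncomputable def truncated (F : Set (Set ℝ)) (ℓ J : ℕ) (Q : Measure ℝ) (n : ℕ)
    (x : ℤ → ℝ) : Measure ℝ :=
  if searchDepth F ℓ J x ≤ (n : ℕ∞) then empirical F ℓ J x else Q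

/-- The process `X` is stationary: its law on the two-sided sequence space is shift invariant. -/
def IsStationary {Ω : Type*} [MeasurableSpace Ω] (μ : Measure Ω) (X : ℤ → Ω → ℝ) : Prop :=
  μ.map (fun ω (t : ℤ) => X (t + 1) ω) = μ.map (fun ω (t : ℤ) => X t ω)

/-- The infinite past `(X_{-1}, X_{-2}, …)`. -/
def past {Ω : Type*} (X : ℤ → Ω → ℝ) (ω : Ω) : ℕ → ℝ := fun i => X (-((i : ℤ) + 1)) ω

/-- The regular conditional distribution `P(dx | X^-)` of `X_0` given the infinite past. -/
noncomputable def condLaw {Ω : Type*} [MeasurableSpace Ω] (μ : Measure Ω) [IsFiniteMeasure μ]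
    (X : ℤ → Ω → ℝ) (ω : Ω) : Measure ℝ :=
  condDistrib (X 0) (past X) μ (past X ω)

/-- Convergence `f n → g` in `L^1(μ)`. -/
def TendstoInL1 {Ω : Type*} [MeasurableSpace Ω] (μ : Measure Ω) (f : ℕ → Ω → ℝ) (g : Ω → ℝ) :
    Prop :=
  (∀ n, MemLp (f n) 1 μ) ∧ MemLp g 1 μ ∧
    Tendsto (fun n => eLpNorm (fun ω => f n ω - g ω) 1 μ) atTop (𝓝 0)

end RecurrenceEstimate

/-! Work with the law `ν` of the process on path space, which the backward shift preserves. Let `S`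
(`pastReturn`) move a path back to the previous occurrence of its own quantized past. Almost surely
the `j`-th sample is the time-zero coordinate of the `j`-th iterate of `S` (`recTime_eq`).

`S` preserves `ν` (`measurePreserving_returnMap`), and a Kac-type bound limits the mean return time
by the number of labels, at most `|Ξ| ^ ℓ` (`lintegral_returnTime_le`). So the mean of `τ_J` is at
most `J |Ξ| ^ ℓ`, and Markov's inequality with the growth condition makes the probability of
truncation at most `ε`. Neither bound needs ergodicity.

For bounded measurable `h` with conditional mean `m` given the past, put `d = h(x 0) - m`. A path
moved by `S` is, at all times up to zero, a function of the strict past of the original path, so `d`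
is orthogonal to `d ∘ S^j` for `j ≥ 1`, and the average of `d` over `J` returns is `O(1/√J)` in
`L¹`. It remains to average `m` itself. If `g` is a function of the label, it is constant along
returns, so by invariance replacing `m` by `g` and back costs `2 ∫ |g - m|`
(`integral_abs_returnAverage_sub_le`). With `g` the conditional expectation given the quantized
past, this error vanishes by Lévy's upward theorem. -/

namespace RecurrenceEstimate

/-! ### First-return maps of a finite partition: Kac bound and invariance. -/

section FirstReturn

variable {α ι : Type*}

/-- One less than the first positive time at which the label `p` of the orbit of `x` under `U` is
again the label of `x` (with the value `0` if there is no such time). -/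
noncomputable def returnGap (U : α → α) (p : α → ι) (x : α) : ℕ :=
  sInf {t | p (U^[t + 1] x) = p x}

/-- The induced map that moves `x` along its orbit to the first return of its label. -/
noncomputable def returnMap (U : α → α) (p : α → ι) (x : α) : α := U^[returnGap U p x + 1] x

variable {U : α → α} {p : α → ι}

theorem label_returnMap {x : α} (hx : ∃ t, p (U^[t + 1] x) = p x) :
    p (returnMap U p x) = p x := Nat.sInf_mem hx

variable [MeasurableSpace α] {μ : Measure α}

theorem measurable_returnMap (hU : Measurable U) (hN : Measurable (returnGap U p)) :
    Measurable (returnMap U p) := by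
  have h : Measurable fun q : ℕ × α => U^[q.1 + 1] q.2 :=
    measurable_from_prod_countable_right fun n => hU.iterate (n + 1)
  exact h.comp (hN.prodMk measurable_id)

/-- The terms sort visits to `D` by the time elapsed since the last visit to `A`. Since `U` need not
be invertible, the sum is telescoped: `e t` is the mass of orbits in `D` at time `t` that avoid `A`
before. Pulling back one step and splitting on whether the start lies in `A` gives the `t`-th term
and `e (t + 1)`. -/
theorem tsum_measure_return_le (hU : MeasurePreserving U μ μ) {A D : Set α}
    (hA : MeasurableSet A) (hD : MeasurableSet D) :
    ∑' t : ℕ, μ (A ∩ {x | ∀ i < t, U^[i + 1] x ∉ A} ∩ U^[t + 1] ⁻¹' D) ≤ μ D := by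
  have hUm (n : ℕ) : Measurable U^[n] := hU.measurable.iterate n
  set e : ℕ → ℝ≥0∞ := fun t => μ ({x | ∀ i < t, U^[i] x ∉ A} ∩ U^[t] ⁻¹' D) with he
  have hC (t : ℕ) : MeasurableSet {x | ∀ i < t, U^[i] x ∉ A} := by
    have : {x | ∀ i < t, U^[i] x ∉ A} = ⋂ i, ⋂ (_ : i < t), (U^[i] ⁻¹' A)ᶜ := by ext; simp
    rw [this]
    exact MeasurableSet.iInter fun i => MeasurableSet.iInter fun _ => (hUm i hA).compl
  have hstep (t : ℕ) :
      e t = μ (A ∩ {x | ∀ i < t, U^[i + 1] x ∉ A} ∩ U^[t + 1] ⁻¹' D) + e (t + 1) := by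
    have hm : MeasurableSet ({x | ∀ i < t, U^[i] x ∉ A} ∩ U^[t] ⁻¹' D) := (hC t).inter (hUm t hD)
    simp only [he]
    rw [← hU.measure_preimage hm.nullMeasurableSet, ← measure_inter_add_sdiff _ hA]
    congr 2
    · ext x
      simp only [Function.iterate_succ_apply, Set.mem_inter_iff, Set.mem_preimage,
        Set.mem_ofPred_eq]
      tauto
    · ext x
      simp only [Set.mem_sdiff, Set.mem_inter_iff, Set.mem_preimage,
        Set.mem_ofPred_eq, Nat.forall_lt_succ_left, Function.iterate_succ_apply,
        Function.iterate_zero_apply]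
      tauto
  have hsum (n : ℕ) : ∑ t ∈ Finset.range n,
      μ (A ∩ {x | ∀ i < t, U^[i + 1] x ∉ A} ∩ U^[t + 1] ⁻¹' D) + e n = e 0 := by
    induction n with
    | zero => simp
    | succ n ih => rw [Finset.sum_range_succ, add_assoc, ← hstep, ih]
  refine ENNReal.tsum_le_of_sum_range_le fun n => ?_
  calc _ ≤ e 0 := by rw [← hsum n]; exact le_self_add
    _ = μ D := by simp [he]

variable [Finite ι]

/-- Kac's lemma as an inequality: the return time is summed over its tails, and the tails within one
label class add up to at most the total mass 1. -/
theorem lintegral_returnTime_le [IsProbabilityMeasure μ] (hU : MeasurePreserving U μ μ)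
    (hp : ∀ w, MeasurableSet (p ⁻¹' {w})) (hN : Measurable (returnGap U p)) :
    ∫⁻ x, ((returnGap U p x + 1 : ℕ) : ℝ≥0∞) ∂μ ≤ Nat.card ι := by
  classical
  have := Fintype.ofFinite ι
  have hrep (x : α) : ((returnGap U p x + 1 : ℕ) : ℝ≥0∞)
      = ∑' t : ℕ, {x | t ≤ returnGap U p x}.indicator 1 x := by
    rw [tsum_eq_sum (s := Finset.range (returnGap U p x + 1))]
    · rw [Finset.sum_congr rfl (g := fun _ => 1)]
      · simp
      · intro t ht
        simp only [Finset.mem_range] at ht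
        simp [Set.indicator, Nat.lt_succ_iff.mp ht]
    · intro t ht
      simp only [Finset.mem_range] at ht
      simp only [Set.indicator_apply_eq_zero, Set.mem_ofPred_eq]
      omega
  have hmeas (t : ℕ) : MeasurableSet {x | t ≤ returnGap U p x} := measurableSet_le (by fun_prop) hN
  simp_rw [hrep]
  rw [lintegral_tsum fun t => (measurable_one.indicator (hmeas t)).aemeasurable]
  simp_rw [lintegral_indicator_one (hmeas _)]
  calc ∑' t : ℕ, μ {x | t ≤ returnGap U p x}
      ≤ ∑' t : ℕ, ∑ w : ι, μ (p ⁻¹' {w} ∩ {x | ∀ i < t, U^[i + 1] x ∉ p ⁻¹' {w}}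
          ∩ U^[t + 1] ⁻¹' Set.univ) := by
        refine ENNReal.tsum_le_tsum fun t => ?_
        refine (measure_mono ?_).trans (measure_iUnion_fintype_le μ _)
        intro x hx
        simp only [Set.mem_iUnion]
        refine ⟨p x, ⟨rfl, fun i hi => ?_⟩, trivial⟩
        exact Nat.notMem_of_lt_sInf (lt_of_lt_of_le hi hx)
    _ = ∑ w : ι, ∑' t : ℕ, μ (p ⁻¹' {w} ∩ {x | ∀ i < t, U^[i + 1] x ∉ p ⁻¹' {w}}
          ∩ U^[t + 1] ⁻¹' Set.univ) :=
        Summable.tsum_finsetSum fun _ _ => ENNReal.summable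
    _ ≤ ∑ w : ι, 1 := Finset.sum_le_sum fun w _ =>
        (tsum_measure_return_le hU (hp w) MeasurableSet.univ).trans (by simp)
    _ = Nat.card ι := by simp

theorem ae_exists_return [IsFiniteMeasure μ] (hU : MeasurePreserving U μ μ)
    (hp : ∀ w, MeasurableSet (p ⁻¹' {w})) : ∀ᵐ x ∂μ, ∃ t, p (U^[t + 1] x) = p x := by
  have h : ∀ w, ∀ᵐ x ∂μ, x ∈ p ⁻¹' {w} → ∃ᶠ n in atTop, U^[n] x ∈ p ⁻¹' {w} := fun w =>
    hU.conservative.ae_mem_imp_frequently_image_mem (hp w).nullMeasurableSet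
  filter_upwards [ae_all_iff.2 h] with x hx
  obtain ⟨n, hn, hn'⟩ := (frequently_atTop.1 (hx (p x) rfl)) 1
  exact ⟨n - 1, by rw [Nat.sub_add_cancel hn]; exact hn'⟩

/-- A return lands in the label class it started from, so the part of the preimage of `E` in class
`w` is controlled by the part of `E` in `w`; summing gives `key`. For a probability measure, `key`
applied to the complement gives the reverse inequality. -/
theorem measurePreserving_returnMap [IsProbabilityMeasure μ] (hU : MeasurePreserving U μ μ)
    (hp : ∀ w, MeasurableSet (p ⁻¹' {w})) (hN : Measurable (returnGap U p)) :
    MeasurePreserving (returnMap U p) μ μ := by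
  classical
  have := Fintype.ofFinite ι
  have hS := measurable_returnMap hU.measurable hN
  refine ⟨hS, ?_⟩
  have key (E : Set α) (hE : MeasurableSet E) : μ (returnMap U p ⁻¹' E) ≤ μ E := by
    calc μ (returnMap U p ⁻¹' E)
        ≤ μ (⋃ w : ι, ⋃ t : ℕ, p ⁻¹' {w} ∩ {x | ∀ i < t, U^[i + 1] x ∉ p ⁻¹' {w}}
          ∩ U^[t + 1] ⁻¹' (p ⁻¹' {w} ∩ E)) := by
          refine measure_mono_ae ?_
          filter_upwards [ae_exists_return hU hp] with x hx hxE
          refine Set.mem_iUnion.2 ⟨p x, Set.mem_iUnion.2 ⟨returnGap U p x, ⟨rfl, fun i hi => ?_⟩,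
            label_returnMap hx, hxE⟩⟩
          exact Nat.notMem_of_lt_sInf hi
      _ ≤ ∑ w : ι, μ (⋃ t : ℕ, p ⁻¹' {w} ∩ {x | ∀ i < t, U^[i + 1] x ∉ p ⁻¹' {w}}
          ∩ U^[t + 1] ⁻¹' (p ⁻¹' {w} ∩ E)) := measure_iUnion_fintype_le μ _
      _ ≤ ∑ w : ι, μ (p ⁻¹' {w} ∩ E) := Finset.sum_le_sum fun w _ =>
          (measure_iUnion_le _).trans (tsum_measure_return_le hU (hp w) ((hp w).inter hE))
      _ = μ E := by
          rw [← measure_biUnion_finset (fun w _ w' _ hww => ?_) fun w _ => (hp w).inter hE]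
          · congr 1; ext x; simp
          · refine Set.disjoint_left.2 fun x hx hx' => hww ?_
            exact hx.1.symm.trans hx'.1
  ext E hE
  rw [Measure.map_apply hS hE]
  refine le_antisymm (key E hE) ?_
  have h1 := key Eᶜ hE.compl
  rw [Set.preimage_compl, prob_compl_eq_one_sub (hS hE), prob_compl_eq_one_sub hE] at h1
  exact (ENNReal.sub_le_sub_iff_left prob_le_one ENNReal.one_ne_top).1 h1

end FirstReturn

/-! ### Averages along a measure preserving map. -/

section Averages

variable {α : Type*} [MeasurableSpace α] {μ : Measure α} {S : α → α}

theorem integrable_of_bounded [IsFiniteMeasure μ] {f : α → ℝ} (hf : Measurable f) {C : ℝ}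
    (hC : ∀ x, |f x| ≤ C) : Integrable f μ :=
  Integrable.of_bound hf.aestronglyMeasurable C (ae_of_all _ hC)

theorem integral_abs_average_le (hS : MeasurePreserving S μ μ) {f : α → ℝ}
    (hf : Integrable f μ) (J : ℕ) :
    ∫ x, |(J : ℝ)⁻¹ * ∑ j ∈ Finset.Icc 1 J, f (S^[j] x)| ∂μ ≤ ∫ x, |f x| ∂μ := by
  have hi (j : ℕ) : Integrable (fun x => f (S^[j] x)) μ :=
    (hS.iterate j).integrable_comp_of_integrable hf
  have he (j : ℕ) : ∫ x, |f (S^[j] x)| ∂μ = ∫ x, |f x| ∂μ := by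
    have := integral_map (hS.iterate j).measurable.aemeasurable (μ := μ) (f := fun x => |f x|)
      (by rw [(hS.iterate j).map_eq]; exact hf.abs.aestronglyMeasurable)
    rw [(hS.iterate j).map_eq] at this
    exact this.symm
  rcases Nat.eq_zero_or_pos J with rfl | hJ
  · simpa using integral_nonneg fun x => abs_nonneg (f x)
  calc ∫ x, |(J : ℝ)⁻¹ * ∑ j ∈ Finset.Icc 1 J, f (S^[j] x)| ∂μ
      ≤ ∫ x, (J : ℝ)⁻¹ * ∑ j ∈ Finset.Icc 1 J, |f (S^[j] x)| ∂μ := by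
        refine integral_mono ((integrable_finsetSum _ fun j _ => hi j).const_mul _).abs
          ((integrable_finsetSum _ fun j _ => (hi j).abs).const_mul _) fun x => ?_
        simp only [abs_mul, abs_inv, Nat.abs_cast]
        gcongr
        exact Finset.abs_sum_le_sum_abs _ _
    _ = ∫ x, |f x| ∂μ := by
        rw [integral_const_mul, integral_finsetSum _ fun j _ => (hi j).abs]
        simp_rw [he]
        have : (J : ℝ) ≠ 0 := by positivity
        simp [this]

/-- Orthogonality of a bounded function to its forward images under a measure preserving map
gives an `L¹` law of large numbers with an explicit rate. -/
theorem integral_abs_average_le_of_orthogonal [IsProbabilityMeasure μ]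
    (hS : MeasurePreserving S μ μ) {d : α → ℝ}
    (hd : Measurable d) {C : ℝ} (hC : ∀ x, |d x| ≤ C)
    (horth : ∀ m : ℕ, ∫ x, d x * d (S^[m + 1] x) ∂μ = 0) {J : ℕ} (hJ : 0 < J) :
    ∫ x, |(J : ℝ)⁻¹ * ∑ j ∈ Finset.Icc 1 J, d (S^[j] x)| ∂μ ≤ (C ^ 2 + 1) / (2 * √J) := by
  have hm (j : ℕ) : Measurable fun x => d (S^[j] x) := hd.comp (hS.measurable.iterate j)
  have hpi (i j : ℕ) : Integrable (fun x => d (S^[i] x) * d (S^[j] x)) μ :=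
    integrable_of_bounded ((hm i).mul (hm j)) (C := C * C) fun x => by
      rw [abs_mul]
      exact mul_le_mul (hC _) (hC _) (abs_nonneg _) ((abs_nonneg _).trans (hC x))
  have hcov (i j : ℕ) :
      ∫ x, d (S^[i] x) * d (S^[j] x) ∂μ = if i = j then ∫ x, d x ^ 2 ∂μ else 0 := by
    have hlt (i k : ℕ) : ∫ x, d (S^[i] x) * d (S^[i + k] x) ∂μ = ∫ x, d x * d (S^[k] x) ∂μ := by
      have := integral_map (hS.iterate i).measurable.aemeasurable (μ := μ)
        (f := fun x => d x * d (S^[k] x)) (hd.mul (hm k)).aestronglyMeasurable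
      rw [(hS.iterate i).map_eq] at this
      simp_rw [add_comm i k, Function.iterate_add_apply]
      exact this.symm
    split_ifs with h
    · subst h
      simpa [sq] using hlt i 0
    · rcases Nat.lt_or_gt_of_ne h with h | h
      · obtain ⟨m, rfl⟩ := Nat.exists_eq_add_of_lt h
        rw [add_assoc, hlt, horth]
      · obtain ⟨m, rfl⟩ := Nat.exists_eq_add_of_lt h
        simp_rw [mul_comm (d (S^[j + m + 1] _))]
        rw [add_assoc, hlt, horth]
  have hd2 : ∫ x, d x ^ 2 ∂μ ≤ C ^ 2 := by
    have : ∫ x, d x ^ 2 ∂μ ≤ ∫ x, C ^ 2 ∂μ := by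
      refine integral_mono (by simpa [sq] using hpi 0 0) (integrable_const _) fun x => ?_
      exact sq_le_sq' (abs_le.1 (hC x)).1 (abs_le.1 (hC x)).2
    simpa using this
  have hexp (x : α) : ((J : ℝ)⁻¹ * ∑ j ∈ Finset.Icc 1 J, d (S^[j] x)) ^ 2
      = (J : ℝ)⁻¹ ^ 2 * ∑ i ∈ Finset.Icc 1 J, ∑ j ∈ Finset.Icc 1 J, d (S^[i] x) * d (S^[j] x) := by
    rw [mul_pow, sq (∑ j ∈ Finset.Icc 1 J, d (S^[j] x)), Finset.sum_mul_sum]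
  have hJ' : (0 : ℝ) < J := by exact_mod_cast hJ
  have hint2 : Integrable (fun x => ((J : ℝ)⁻¹ * ∑ j ∈ Finset.Icc 1 J, d (S^[j] x)) ^ 2) μ := by
    simp_rw [hexp]
    exact (integrable_finsetSum _ fun i _ => integrable_finsetSum _ fun j _ => hpi i j).const_mul _
  have hL2 : ∫ x, ((J : ℝ)⁻¹ * ∑ j ∈ Finset.Icc 1 J, d (S^[j] x)) ^ 2 ∂μ ≤ C ^ 2 / J := by
    simp_rw [hexp]
    rw [integral_const_mul, integral_finsetSum _ fun i _ => integrable_finsetSum _ fun j _ => hpi i j]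
    simp_rw [integral_finsetSum _ fun j _ => hpi _ j, hcov]
    rw [Finset.sum_congr rfl (g := fun _ => ∫ x, d x ^ 2 ∂μ)]
    · simp only [Finset.sum_const, Nat.card_Icc, add_tsub_cancel_right, nsmul_eq_mul]
      rw [show (J : ℝ)⁻¹ ^ 2 * (J * ∫ x, d x ^ 2 ∂μ) = (∫ x, d x ^ 2 ∂μ) / J by field_simp]
      gcongr
    · intro i hi
      rw [Finset.sum_ite_eq, if_pos hi]
  have hs : 0 < √(J : ℝ) := Real.sqrt_pos.2 hJ'
  have hsq : √(J : ℝ) ^ 2 = J := Real.sq_sqrt hJ'.le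
  -- Passage from `L²` to `L¹`; the weight `√J` balances the second moment, of order `1/J`, against
  -- the constant term.
  have hpt (y : ℝ) : |y| ≤ √J / 2 * y ^ 2 + 1 / (2 * √J) := by
    rw [← sq_abs y]
    have h := sq_nonneg (√(J : ℝ) * |y| - 1)
    rw [← sub_nonneg]
    have : √(J : ℝ) / 2 * |y| ^ 2 + 1 / (2 * √J) - |y| = (√(J : ℝ) * |y| - 1) ^ 2 / (2 * √J) := by
      field_simp; ring
    rw [this]
    positivity
  calc ∫ x, |(J : ℝ)⁻¹ * ∑ j ∈ Finset.Icc 1 J, d (S^[j] x)| ∂μ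
      ≤ ∫ x, (√J / 2 * ((J : ℝ)⁻¹ * ∑ j ∈ Finset.Icc 1 J, d (S^[j] x)) ^ 2 + 1 / (2 * √J)) ∂μ := by
        refine integral_mono ?_ ((hint2.const_mul _).add (integrable_const _)) fun x => hpt _
        exact ((integrable_finsetSum _ fun j _ =>
          integrable_of_bounded (hm j) fun x => hC _).const_mul _).abs
    _ = √J / 2 * ∫ x, ((J : ℝ)⁻¹ * ∑ j ∈ Finset.Icc 1 J, d (S^[j] x)) ^ 2 ∂μ + 1 / (2 * √J) := by
        rw [integral_add (hint2.const_mul _) (integrable_const _), integral_const_mul]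
        simp
    _ ≤ √J / 2 * (C ^ 2 / J) + 1 / (2 * √J) := by gcongr
    _ = (C ^ 2 + 1) / (2 * √J) := by
        have : C ^ 2 / (J : ℝ) = C ^ 2 / √J ^ 2 := by rw [hsq]
        rw [this]
        field_simp

end Averages

/-! ### Recurrence times as iterated first returns on path space. -/

section Paths

/-- The shift of a path by one time unit into the past. -/
def shiftBack (x : ℤ → ℝ) : ℤ → ℝ := fun t => x (t - 1)

theorem shiftBack_iterate (n : ℕ) (x : ℤ → ℝ) (t : ℤ) : shiftBack^[n] x t = x (t - n) := by
  induction n generalizing t with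
  | zero => simp
  | succ n ih =>
    rw [Function.iterate_succ_apply', shiftBack, ih]
    congr 1
    push_cast
    ring

/-- The quantized `ℓ`-past of a path. -/
def pastLabel (F : Set (Set ℝ)) (ℓ : ℕ) (x : ℤ → ℝ) : Finset.Icc 1 ℓ → atoms F :=
  fun i => ⟨quantize F (x (-((i : ℕ) : ℤ))), Set.mem_range_self _⟩

theorem pastLabel_eq_iff {F : Set (Set ℝ)} {ℓ : ℕ} {x y : ℤ → ℝ} :
    pastLabel F ℓ x = pastLabel F ℓ y ↔
      ∀ i ∈ Finset.Icc 1 ℓ, quantize F (x (-(i : ℤ))) = quantize F (y (-(i : ℤ))) := by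
  simp [funext_iff, pastLabel, Subtype.ext_iff]

theorem samePast_iff {F : Set (Set ℝ)} {ℓ : ℕ} {x : ℤ → ℝ} {t : ℕ} :
    SamePast F ℓ x t ↔ pastLabel F ℓ (shiftBack^[t] x) = pastLabel F ℓ x := by
  simp [SamePast, pastLabel_eq_iff, shiftBack_iterate]

theorem quantize_eq_iff {F : Set (Set ℝ)} {a b : ℝ} :
    quantize F a = quantize F b ↔ ∀ s ∈ F, a ∈ s ↔ b ∈ s := by
  have hmem (c : ℝ) : c ∈ quantize F c := fun s hs => hs.2
  constructor
  · intro h s hs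
    constructor
    · intro ha
      have hb : b ∈ quantize F a := h ▸ hmem b
      exact hb s ⟨hs, ha⟩
    · intro hb
      have ha : a ∈ quantize F b := h ▸ hmem a
      exact ha s ⟨hs, hb⟩
  · intro h
    have : {s ∈ F | a ∈ s} = {s ∈ F | b ∈ s} := by
      ext s
      exact and_congr_right fun hs => h s hs
    rw [quantize, quantize, this]

theorem finite_atoms {F : Set (Set ℝ)} (hF : F.Finite) : (atoms F).Finite := by
  refine (hF.finite_subsets.image Set.sInter).subset ?_
  rintro _ ⟨x, rfl⟩
  exact ⟨_, Set.sep_subset _ _, rfl⟩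

theorem card_pastLabel (F : Set (Set ℝ)) (ℓ : ℕ) :
    Nat.card (Finset.Icc 1 ℓ → atoms F) = (atoms F).ncard ^ ℓ := by
  rw [Nat.card_fun, Nat.card_coe_set_eq, Nat.card_eq_fintype_card, Fintype.card_coe]
  simp

/-- The first return time (minus one) of the quantized past, looking backwards in time. -/
noncomputable abbrev pastGap (F : Set (Set ℝ)) (ℓ : ℕ) : (ℤ → ℝ) → ℕ :=
  returnGap shiftBack (pastLabel F ℓ)

/-- The shift of a path back to the previous occurrence of its quantized past. -/
noncomputable abbrev pastReturn (F : Set (Set ℝ)) (ℓ : ℕ) : (ℤ → ℝ) → ℤ → ℝ :=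
  returnMap shiftBack (pastLabel F ℓ)

/-- The quantized past of the path recurs infinitely often. -/
def IsRecurrent (F : Set (Set ℝ)) (ℓ : ℕ) (x : ℤ → ℝ) : Prop :=
  ∀ i : ℕ, ∃ t, pastLabel F ℓ (shiftBack^[t + 1] ((pastReturn F ℓ)^[i] x))
    = pastLabel F ℓ ((pastReturn F ℓ)^[i] x)

/-- The sum of the first `j` return times. -/
noncomputable def returnSum (F : Set (Set ℝ)) (ℓ : ℕ) (j : ℕ) (x : ℤ → ℝ) : ℕ :=
  ∑ i ∈ Finset.range j, (pastGap F ℓ ((pastReturn F ℓ)^[i] x) + 1)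

variable {F : Set (Set ℝ)} {ℓ : ℕ} {x : ℤ → ℝ}

theorem pastReturn_iterate (j : ℕ) :
    (pastReturn F ℓ)^[j] x = shiftBack^[returnSum F ℓ j x] x := by
  induction j with
  | zero => simp [returnSum]
  | succ j ih =>
    have hsucc : returnSum F ℓ (j + 1) x
        = (pastGap F ℓ ((pastReturn F ℓ)^[j] x) + 1) + returnSum F ℓ j x :=
      (Finset.sum_range_succ _ _).trans (add_comm _ _)
    rw [Function.iterate_succ_apply', hsucc, Function.iterate_add_apply, ← ih]
    rfl

theorem pastLabel_pastReturn_iterate (hx : IsRecurrent F ℓ x) (j : ℕ) :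
    pastLabel F ℓ ((pastReturn F ℓ)^[j] x) = pastLabel F ℓ x := by
  induction j with
  | zero => rfl
  | succ j ih => rw [Function.iterate_succ_apply', label_returnMap (hx j), ih]

/-- Returns keep the label, so matching the original past is the same as matching the past of the
current iterate; successive recurrence times thus differ by first-return times. -/
theorem recTime_eq (hx : IsRecurrent F ℓ x) (j : ℕ) :
    recTime F ℓ x j = (returnSum F ℓ j x : ℕ) := by
  induction j with
  | zero => simp [recTime, returnSum]
  | succ j ih =>
    have hsame (u : ℕ) : SamePast F ℓ x (returnSum F ℓ j x + (u + 1)) ↔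
        pastLabel F ℓ (shiftBack^[u + 1] ((pastReturn F ℓ)^[j] x))
          = pastLabel F ℓ ((pastReturn F ℓ)^[j] x) := by
      rw [samePast_iff, add_comm, Function.iterate_add_apply, ← pastReturn_iterate,
        pastLabel_pastReturn_iterate hx]
    have hsucc : returnSum F ℓ (j + 1) x
        = returnSum F ℓ j x + (pastGap F ℓ ((pastReturn F ℓ)^[j] x) + 1) :=
      Finset.sum_range_succ _ _
    rw [recTime]
    apply le_antisymm
    · refine iInf_le_of_le ⟨returnSum F ℓ (j + 1) x, ?_, ?_⟩ le_rfl
      · rw [ih, hsucc]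
        norm_cast
        omega
      · rw [hsucc, hsame]
        exact Nat.sInf_mem (hx j)
    · refine le_iInf ?_
      rintro ⟨t, ht, hst⟩
      rw [ih] at ht
      obtain ⟨u, rfl⟩ := Nat.exists_eq_add_of_lt (Nat.cast_lt.1 ht)
      rw [add_assoc, hsame] at hst
      have hu : pastGap F ℓ ((pastReturn F ℓ)^[j] x) ≤ u := Nat.sInf_le hst
      simp only [hsucc]
      norm_cast
      omega

end Paths

/-! ### Measurability with respect to the strict past. -/

section PathMeasurability

variable {F : Set (Set ℝ)} {ℓ : ℕ}

theorem measurableSet_quantize_eq {β : Type*} [MeasurableSpace β] (hF : F.Finite)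
    (hFm : ∀ s ∈ F, MeasurableSet s) {f g : β → ℝ} (hf : Measurable f) (hg : Measurable g) :
    MeasurableSet {b | quantize F (f b) = quantize F (g b)} := by
  have : {b | quantize F (f b) = quantize F (g b)} = ⋂ s ∈ F, {b | f b ∈ s ↔ g b ∈ s} := by
    ext b
    simp [quantize_eq_iff]
  rw [this]
  refine MeasurableSet.biInter hF.countable fun s hs => ?_
  exact MeasurableSet.iff (hf (hFm s hs)) (hg (hFm s hs))

/-- The σ-algebra on `β` is left free and measurability is asked of strict-past coordinates alone,
so that this and the next lemmas serve both the product σ-algebra and `pastSigma`. -/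
theorem measurableSet_pastLabel_eq {β : Type*} [MeasurableSpace β] (hF : F.Finite)
    (hFm : ∀ s ∈ F, MeasurableSet s) {Y Z : β → ℤ → ℝ}
    (hY : ∀ i : ℕ, Measurable fun b => Y b (-((i : ℤ) + 1)))
    (hZ : ∀ i : ℕ, Measurable fun b => Z b (-((i : ℤ) + 1))) :
    MeasurableSet {b | pastLabel F ℓ (Y b) = pastLabel F ℓ (Z b)} := by
  simp_rw [pastLabel_eq_iff, Set.ofPred_forall]
  refine Finset.measurableSet_biInter _ fun i hi => ?_
  obtain ⟨j, rfl⟩ := Nat.exists_eq_add_of_le' (Finset.mem_Icc.1 hi).1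
  push_cast
  exact measurableSet_quantize_eq hF hFm (hY j) (hZ j)

theorem measurable_pastGap {β : Type*} [MeasurableSpace β] (hF : F.Finite)
    (hFm : ∀ s ∈ F, MeasurableSet s) {Y : β → ℤ → ℝ}
    (hY : ∀ i : ℕ, Measurable fun b => Y b (-((i : ℤ) + 1))) :
    Measurable fun b => pastGap F ℓ (Y b) := by
  have hs (t : ℕ) : MeasurableSet
      {b | pastLabel F ℓ (shiftBack^[t + 1] (Y b)) = pastLabel F ℓ (Y b)} := by
    refine measurableSet_pastLabel_eq hF hFm (fun i => ?_) hY
    convert hY (i + t + 1) using 2 with b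
    rw [shiftBack_iterate]
    congr 1
  refine measurable_of_Iic fun n => ?_
  -- Points that never return have the default gap 0 and so lie in every sublevel set.
  have : (fun b => pastGap F ℓ (Y b)) ⁻¹' Set.Iic n
      = (⋃ t ∈ Finset.range (n + 1),
          {b | pastLabel F ℓ (shiftBack^[t + 1] (Y b)) = pastLabel F ℓ (Y b)})
        ∪ ⋂ t, {b | pastLabel F ℓ (shiftBack^[t + 1] (Y b)) = pastLabel F ℓ (Y b)}ᶜ := by
    ext b
    simp only [Set.mem_preimage, Set.mem_Iic, Set.mem_union, Set.mem_iUnion, Finset.mem_range,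
      Set.mem_iInter, Set.mem_compl_iff, Set.mem_ofPred_eq, exists_prop]
    constructor
    · intro h
      by_cases hex : ∃ t, pastLabel F ℓ (shiftBack^[t + 1] (Y b)) = pastLabel F ℓ (Y b)
      · exact Or.inl ⟨_, Nat.lt_succ_of_le h, Nat.sInf_mem hex⟩
      · exact Or.inr (not_exists.1 hex)
    · rintro (⟨t, ht, h⟩ | h)
      · exact (Nat.sInf_le h).trans (Nat.lt_succ_iff.1 ht)
      · have : pastGap F ℓ (Y b) = 0 := Nat.sInf_eq_zero.2 (Or.inr (by
          ext t; simpa using h t))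
        omega
  rw [this]
  exact (Finset.measurableSet_biUnion _ fun t _ => hs t).union
    (MeasurableSet.iInter fun t => (hs t).compl)

/-- The shift is by the gap plus one, hence at least one: even for `i = 0` the value is read off a
strict-past coordinate of the original path. -/
theorem measurable_pastReturn_apply {β : Type*} [MeasurableSpace β] (hF : F.Finite)
    (hFm : ∀ s ∈ F, MeasurableSet s) {Y : β → ℤ → ℝ}
    (hY : ∀ i : ℕ, Measurable fun b => Y b (-((i : ℤ) + 1))) (i : ℕ) :
    Measurable fun b => pastReturn F ℓ (Y b) (-(i : ℤ)) := by
  have h : Measurable fun q : ℕ × β => Y q.2 (-(((i + q.1 : ℕ) : ℤ) + 1)) :=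
    measurable_from_prod_countable_right fun n => hY (i + n)
  convert h.comp ((measurable_pastGap (ℓ := ℓ) hF hFm hY).prodMk measurable_id) using 2 with b
  simp only [pastReturn, returnMap, shiftBack_iterate, Function.comp, id]
  congr 1
  push_cast
  ring

/-- The iterates of the return map see the present only through the strict past. -/
theorem measurable_pastReturn_iterate_apply {β : Type*} [MeasurableSpace β] (hF : F.Finite)
    (hFm : ∀ s ∈ F, MeasurableSet s) {Y : β → ℤ → ℝ}
    (hY : ∀ i : ℕ, Measurable fun b => Y b (-((i : ℤ) + 1))) (m i : ℕ) :
    Measurable fun b => (pastReturn F ℓ)^[m + 1] (Y b) (-(i : ℤ)) := by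
  induction m generalizing i with
  | zero => exact measurable_pastReturn_apply hF hFm hY i
  | succ m ih =>
    simp_rw [Function.iterate_succ_apply' _ (m + 1)]
    refine measurable_pastReturn_apply hF hFm (fun i => ?_) i
    exact_mod_cast ih (i + 1)

end PathMeasurability

/-! ### Bounds on the search depth. -/

section SearchDepth

variable {F : Set (Set ℝ)} {ℓ : ℕ} {ν : Measure (ℤ → ℝ)}

theorem measurable_pastGap_id (hF : F.Finite) (hFm : ∀ s ∈ F, MeasurableSet s) :
    Measurable (pastGap F ℓ) :=
  measurable_pastGap (Y := id) hF hFm fun _ => measurable_pi_apply _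

theorem measurableSet_pastLabel_fiber (hF : F.Finite) (hFm : ∀ s ∈ F, MeasurableSet s)
    (w : Finset.Icc 1 ℓ → atoms F) : MeasurableSet (pastLabel F ℓ ⁻¹' {w}) := by
  by_cases h : ∃ y, pastLabel F ℓ y = w
  · obtain ⟨y, rfl⟩ := h
    exact measurableSet_pastLabel_eq (Y := id) (Z := fun _ => y) hF hFm
      (fun _ => measurable_pi_apply _) fun _ => measurable_const
  · rw [show pastLabel F ℓ ⁻¹' {w} = ∅ by ext y; simpa using fun hy => h ⟨y, hy⟩]
    exact MeasurableSet.empty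

variable [IsProbabilityMeasure ν]

theorem measurePreserving_pastReturn (hν : MeasurePreserving shiftBack ν ν) (hF : F.Finite)
    (hFm : ∀ s ∈ F, MeasurableSet s) : MeasurePreserving (pastReturn F ℓ) ν ν :=
  have := (finite_atoms hF).to_subtype
  measurePreserving_returnMap hν (measurableSet_pastLabel_fiber hF hFm)
    (measurable_pastGap_id hF hFm)

theorem ae_isRecurrent (hν : MeasurePreserving shiftBack ν ν) (hF : F.Finite)
    (hFm : ∀ s ∈ F, MeasurableSet s) : ∀ᵐ x ∂ν, IsRecurrent F ℓ x := by
  have := (finite_atoms hF).to_subtype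
  refine ae_all_iff.2 fun i => ?_
  exact ((measurePreserving_pastReturn hν hF hFm).iterate i).quasiMeasurePreserving.ae
    (ae_exists_return hν (measurableSet_pastLabel_fiber hF hFm))

theorem measurable_returnSum (hF : F.Finite) (hFm : ∀ s ∈ F, MeasurableSet s)
    (hS : Measurable (pastReturn F ℓ)) (j : ℕ) : Measurable (returnSum F ℓ j) :=
  Finset.measurable_sum _ fun i _ =>
    ((measurable_pastGap_id hF hFm).comp (hS.iterate i)).add_const 1

theorem lintegral_returnSum_le (hν : MeasurePreserving shiftBack ν ν) (hF : F.Finite)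
    (hFm : ∀ s ∈ F, MeasurableSet s) (j : ℕ) :
    ∫⁻ x, (returnSum F ℓ j x : ℝ≥0∞) ∂ν ≤ j * ((atoms F).ncard : ℝ≥0∞) ^ ℓ := by
  have := (finite_atoms hF).to_subtype
  have hS := measurePreserving_pastReturn (ℓ := ℓ) hν hF hFm
  have hg : Measurable fun x => ((pastGap F ℓ x + 1 : ℕ) : ℝ≥0∞) :=
    measurable_from_top.comp ((measurable_pastGap_id hF hFm).add_const 1)
  simp only [returnSum, Nat.cast_sum]
  calc _ = ∑ i ∈ Finset.range j,
          ∫⁻ x, ((pastGap F ℓ ((pastReturn F ℓ)^[i] x) + 1 : ℕ) : ℝ≥0∞) ∂ν :=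
        lintegral_finsetSum _ fun i _ => hg.comp (hS.measurable.iterate i)
    _ = ∑ i ∈ Finset.range j, ∫⁻ x, ((pastGap F ℓ x + 1 : ℕ) : ℝ≥0∞) ∂ν :=
        Finset.sum_congr rfl fun i _ => (hS.iterate i).lintegral_comp hg
    _ ≤ ∑ i ∈ Finset.range j, ((atoms F).ncard : ℝ≥0∞) ^ ℓ := by
        refine Finset.sum_le_sum fun i _ => ?_
        refine (lintegral_returnTime_le hν (measurableSet_pastLabel_fiber hF hFm)
          (measurable_pastGap_id hF hFm)).trans ?_
        rw [card_pastLabel]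
        norm_cast
    _ = _ := by simp

theorem measureReal_lt_returnSum_le (hν : MeasurePreserving shiftBack ν ν) (hF : F.Finite)
    (hFm : ∀ s ∈ F, MeasurableSet s) {J n : ℕ} (hJ : 0 < J) {ε : ℝ} (hε : 0 < ε)
    (hn : (ℓ : ℝ) + J * ((atoms F).ncard : ℝ) ^ ℓ / ε ≤ n) :
    ν.real {x | n < ℓ + returnSum F ℓ J x} ≤ ε := by
  -- `K` bounds the mean of `returnSum`; the event forces `returnSum` above `K / ε`, and Markov's
  -- inequality yields `ε` once `K > 0` is cancelled.
  set K : ℝ := J * ((atoms F).ncard : ℝ) ^ ℓ with hK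
  have hcard : 0 < (atoms F).ncard :=
    (Set.ncard_pos (finite_atoms hF)).2 ⟨_, Set.mem_range_self 0⟩
  have hKpos : 0 < K := by positivity
  have hm := measurable_returnSum (ℓ := ℓ) hF hFm
    (measurePreserving_pastReturn (ν := ν) hν hF hFm).measurable J
  have hMarkov := mul_meas_ge_le_lintegral (μ := ν)
    (measurable_from_top.comp hm : Measurable fun x => (returnSum F ℓ J x : ℝ≥0∞))
    (ENNReal.ofReal (K / ε))
  have hle : ν {x | n < ℓ + returnSum F ℓ J x} ≤
      ν {x | ENNReal.ofReal (K / ε) ≤ (returnSum F ℓ J x : ℝ≥0∞)} := by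
    refine measure_mono fun x hx => ?_
    have hx' : (n : ℝ) < ℓ + returnSum F ℓ J x := by exact_mod_cast hx
    rw [Set.mem_ofPred_eq, ← ENNReal.ofReal_natCast]
    exact ENNReal.ofReal_le_ofReal (by linarith)
  have hb : ENNReal.ofReal (K / ε) * ν {x | n < ℓ + returnSum F ℓ J x} ≤ ENNReal.ofReal K := by
    refine (mul_le_mul_right hle _).trans (hMarkov.trans ((lintegral_returnSum_le hν hF hFm J).trans ?_))
    rw [hK, ENNReal.ofReal_mul (by positivity), ENNReal.ofReal_pow (by positivity)]
    simp
  have hb' : K / ε * ν.real {x | n < ℓ + returnSum F ℓ J x} ≤ K := by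
    have := ENNReal.toReal_mono ENNReal.ofReal_ne_top hb
    rwa [ENNReal.toReal_mul, ENNReal.toReal_ofReal (by positivity),
      ENNReal.toReal_ofReal hKpos.le] at this
  rw [div_mul_eq_mul_div, div_le_iff₀ hε] at hb'
  exact le_of_mul_le_mul_left hb' hKpos

theorem searchDepth_eq {x : ℤ → ℝ} (hx : IsRecurrent F ℓ x) (J : ℕ) :
    searchDepth F ℓ J x = ((ℓ + returnSum F ℓ J x : ℕ) : ℕ∞) := by
  rw [searchDepth, recTime_eq hx]
  norm_cast

end SearchDepth

/-! ### Integrals against the empirical and truncated measures. -/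

section Empirical

variable {F : Set (Set ℝ)} {ℓ : ℕ}

/-- The average of `f` along the first `J` returns of the quantized past. -/
noncomputable def returnAverage (F : Set (Set ℝ)) (ℓ J : ℕ) (f : (ℤ → ℝ) → ℝ) (x : ℤ → ℝ) : ℝ :=
  (J : ℝ)⁻¹ * ∑ j ∈ Finset.Icc 1 J, f ((pastReturn F ℓ)^[j] x)

theorem integral_empirical {x : ℤ → ℝ} (hx : IsRecurrent F ℓ x) (J : ℕ) {h : ℝ → ℝ}
    (hh : Measurable h) :
    ∫ y, h y ∂(empirical F ℓ J x) = returnAverage F ℓ J (fun x => h (x 0)) x := by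
  rw [empirical, integral_smul_measure, integral_finsetSum_measure]
  · simp only [returnAverage, ENNReal.toReal_inv, ENNReal.toReal_natCast, smul_eq_mul]
    congr 1
    refine Finset.sum_congr rfl fun j _ => ?_
    rw [integral_dirac' _ _ hh.stronglyMeasurable, recTime_eq hx, pastReturn_iterate,
      shiftBack_iterate]
    simp
  · intro j _
    exact integrable_dirac' hh.stronglyMeasurable (by simp)

open Classical in
theorem integral_truncated {x : ℤ → ℝ} (hx : IsRecurrent F ℓ x) (J n : ℕ) (Q : Measure ℝ)
    {h : ℝ → ℝ} (hh : Measurable h) :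
    ∫ y, h y ∂(truncated F ℓ J Q n x) =
      if ℓ + returnSum F ℓ J x ≤ n then returnAverage F ℓ J (fun x => h (x 0)) x
      else ∫ y, h y ∂Q := by
  rw [truncated, searchDepth_eq hx]
  simp only [Nat.cast_le]
  split_ifs
  · exact integral_empirical hx J hh
  · rfl

end Empirical

/-! ### The conditional mean and orthogonality along returns. -/

section ConditionalLaw

/-- The σ-algebra on the path space generated by the strict past. -/
abbrev pastSigma : MeasurableSpace (ℤ → ℝ) :=
  MeasurableSpace.comap (past fun t (x : ℤ → ℝ) => x t) inferInstance

theorem measurable_past : Measurable (past fun t (x : ℤ → ℝ) => x t) :=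
  measurable_pi_iff.2 fun _ => measurable_pi_apply _

theorem pastSigma_le : pastSigma ≤ (inferInstance : MeasurableSpace (ℤ → ℝ)) :=
  measurable_past.comap_le

theorem measurable_pastSigma_apply (i : ℕ) :
    Measurable[pastSigma] fun x : ℤ → ℝ => x (-((i : ℤ) + 1)) :=
  (measurable_pi_apply i).comp (comap_measurable (past fun t (x : ℤ → ℝ) => x t))

variable {ν : Measure (ℤ → ℝ)} [IsProbabilityMeasure ν] {h : ℝ → ℝ} {M : ℝ}

/-- The conditional expectation of `h (x 0)` given the past, as an integral against the regular
conditional distribution. -/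
noncomputable def condMean (ν : Measure (ℤ → ℝ)) [IsProbabilityMeasure ν] (h : ℝ → ℝ)
    (x : ℤ → ℝ) : ℝ := ∫ y, h y ∂(condLaw ν (fun t (x : ℤ → ℝ) => x t) x)

instance {Ω : Type*} [MeasurableSpace Ω] (μ : Measure Ω) [IsFiniteMeasure μ]
    (X : ℤ → Ω → ℝ) (ω : Ω) : IsProbabilityMeasure (condLaw μ X ω) := by
  unfold condLaw; infer_instance

theorem abs_condMean_le (hM : ∀ y, |h y| ≤ M) (x : ℤ → ℝ) : |condMean ν h x| ≤ M := by
  have := norm_integral_le_of_norm_le_const (μ := condLaw ν (fun t (x : ℤ → ℝ) => x t) x)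
    (ae_of_all _ fun y => (Real.norm_eq_abs (h y)).le.trans (hM y))
  simpa [condMean] using this

theorem stronglyMeasurable_condMean (hh : Measurable h) :
    StronglyMeasurable[pastSigma] (condMean ν h) :=
  stronglyMeasurable_integral_condDistrib (f := fun q : (ℕ → ℝ) × ℝ => h q.2)
    (hh.comp measurable_snd).stronglyMeasurable

theorem measurable_condMean (hh : Measurable h) : Measurable (condMean ν h) :=
  ((stronglyMeasurable_condMean hh).mono pastSigma_le).measurable

theorem condExp_ae_eq_condMean (hh : Measurable h) (hM : ∀ y, |h y| ≤ M) :
    ν[fun x => h (x 0) | pastSigma] =ᵐ[ν] condMean ν h :=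
  condExp_ae_eq_integral_condDistrib measurable_past (measurable_pi_apply 0).aemeasurable
    hh.stronglyMeasurable
    (integrable_of_bounded (hh.comp (measurable_pi_apply 0)) fun _ => hM _)

theorem abs_sub_condMean_le (hM : ∀ y, |h y| ≤ M) (x : ℤ → ℝ) :
    |h (x 0) - condMean ν h x| ≤ 2 * M :=
  (abs_sub _ _).trans (by linarith [hM (x 0), abs_condMean_le (ν := ν) hM x])

variable {F : Set (Set ℝ)} {ℓ : ℕ}

theorem measurable_sub_condMean_pastReturn_iterate {β : Type*} [MeasurableSpace β] (hF : F.Finite)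
    (hFm : ∀ s ∈ F, MeasurableSet s) (hh : Measurable h) {Y : β → ℤ → ℝ}
    (hY : ∀ i : ℕ, Measurable fun b => Y b (-((i : ℤ) + 1))) (m : ℕ) :
    Measurable fun b => h ((pastReturn F ℓ)^[m + 1] (Y b) 0)
      - condMean ν h ((pastReturn F ℓ)^[m + 1] (Y b)) := by
  have hcoord := measurable_pastReturn_iterate_apply (ℓ := ℓ) hF hFm hY m
  refine Measurable.sub (hh.comp (by simpa using hcoord 0)) ?_
  have hc : Measurable fun z : ℕ → ℝ =>
      ∫ y, h y ∂(condDistrib (fun x : ℤ → ℝ => x 0) (past fun t (x : ℤ → ℝ) => x t) ν z) :=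
    (StronglyMeasurable.integral_condDistrib (f := fun q : (ℕ → ℝ) × ℝ => h q.2)
      (hh.comp measurable_snd).stronglyMeasurable).measurable
  refine hc.comp (measurable_pi_iff.2 fun i => ?_)
  exact_mod_cast hcoord (i + 1)

/-- The second factor is `pastSigma`-measurable, so it can be pulled out of the conditional
expectation given the past, under which the first factor has mean zero. -/
theorem integral_sub_condMean_mul (hF : F.Finite) (hFm : ∀ s ∈ F, MeasurableSet s)
    (hh : Measurable h) (hM : ∀ y, |h y| ≤ M) (m : ℕ) :
    ∫ x, (h (x 0) - condMean ν h x) * (h ((pastReturn F ℓ)^[m + 1] x 0)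
      - condMean ν h ((pastReturn F ℓ)^[m + 1] x)) ∂ν = 0 := by
  set Y : (ℤ → ℝ) → ℝ := fun x => h ((pastReturn F ℓ)^[m + 1] x 0)
      - condMean ν h ((pastReturn F ℓ)^[m + 1] x) with hY
  have hYm : Measurable[pastSigma] Y :=
    @measurable_sub_condMean_pastReturn_iterate ν _ h F ℓ _ pastSigma hF hFm hh id
      measurable_pastSigma_apply m
  have hYm' : Measurable Y := hYm.mono pastSigma_le le_rfl
  have hYb (x : ℤ → ℝ) : |Y x| ≤ 2 * M := abs_sub_condMean_le hM _
  have h0m : Measurable fun x : ℤ → ℝ => h (x 0) := hh.comp (measurable_pi_apply 0)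
  have hM0 : 0 ≤ M := (abs_nonneg _).trans (hM 0)
  have hi1 : Integrable (fun x => h (x 0) * Y x) ν :=
    integrable_of_bounded (h0m.mul hYm') (C := M * (2 * M)) fun x => by
      rw [abs_mul]; exact mul_le_mul (hM _) (hYb x) (abs_nonneg _) hM0
  have hi2 : Integrable (fun x => condMean ν h x * Y x) ν :=
    integrable_of_bounded ((measurable_condMean hh).mul hYm') (C := M * (2 * M)) fun x => by
      rw [abs_mul]; exact mul_le_mul (abs_condMean_le hM x) (hYb x) (abs_nonneg _) hM0
  have hpull : ν[(fun x => h (x 0)) * Y | pastSigma] =ᵐ[ν]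
      ν[fun x => h (x 0) | pastSigma] * Y :=
    condExp_mul_of_aestronglyMeasurable_right hYm.stronglyMeasurable.aestronglyMeasurable hi1
      (integrable_of_bounded h0m fun _ => hM _)
  have he : ∫ x, h (x 0) * Y x ∂ν = ∫ x, condMean ν h x * Y x ∂ν := by
    rw [← integral_condExp pastSigma_le (f := fun x => h (x 0) * Y x)]
    refine integral_congr_ae ?_
    filter_upwards [hpull, condExp_ae_eq_condMean (ν := ν) hh hM] with x hx hx'
    rw [← hx']
    exact hx
  simp_rw [sub_mul]
  rw [integral_sub hi1 hi2, he, sub_self]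

/-- The averages along the returns are close to the conditional mean as soon as the conditional
mean is close to a function `g` of the quantized past. -/
theorem integral_abs_returnAverage_sub_le (hν : MeasurePreserving shiftBack ν ν) (hF : F.Finite)
    (hFm : ∀ s ∈ F, MeasurableSet s) (hh : Measurable h) (hM : ∀ y, |h y| ≤ M)
    {J : ℕ} (hJ : 0 < J) {g : (ℤ → ℝ) → ℝ} (hg : Integrable g ν)
    (hlabel : ∀ x y, pastLabel F ℓ x = pastLabel F ℓ y → g x = g y) :
    ∫ x, |returnAverage F ℓ J (fun x => h (x 0)) x - condMean ν h x| ∂ν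
      ≤ ((2 * M) ^ 2 + 1) / (2 * √J) + 2 * ∫ x, |g x - condMean ν h x| ∂ν := by
  have hS := measurePreserving_pastReturn (ℓ := ℓ) hν hF hFm
  have hcm : Integrable (condMean ν h) ν :=
    integrable_of_bounded (measurable_condMean hh) (abs_condMean_le hM)
  have hd : Measurable fun x : ℤ → ℝ => h (x 0) - condMean ν h x :=
    (hh.comp (measurable_pi_apply 0)).sub (measurable_condMean hh)
  have hdi : Integrable (fun x : ℤ → ℝ => h (x 0) - condMean ν h x) ν :=
    integrable_of_bounded hd (abs_sub_condMean_le hM)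
  have h1 := integral_abs_average_le_of_orthogonal hS hd (abs_sub_condMean_le hM)
    (integral_sub_condMean_mul (ℓ := ℓ) hF hFm hh hM) hJ
  have h2 := integral_abs_average_le hS (hg.sub hcm) J
  have hint {f : (ℤ → ℝ) → ℝ} (hf : Integrable f ν) : Integrable
      (fun x => |(J : ℝ)⁻¹ * ∑ j ∈ Finset.Icc 1 J, f ((pastReturn F ℓ)^[j] x)|) ν :=
    ((integrable_finsetSum _ fun j _ =>
      (hS.iterate j).integrable_comp_of_integrable hf).const_mul _).abs
  have hJ' : (J : ℝ) ≠ 0 := by positivity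
  have hpt : ∀ᵐ x ∂ν, |returnAverage F ℓ J (fun x => h (x 0)) x - condMean ν h x| ≤
      |(J : ℝ)⁻¹ * ∑ j ∈ Finset.Icc 1 J,
        (h ((pastReturn F ℓ)^[j] x 0) - condMean ν h ((pastReturn F ℓ)^[j] x))|
      + (|(J : ℝ)⁻¹ * ∑ j ∈ Finset.Icc 1 J, (g - condMean ν h) ((pastReturn F ℓ)^[j] x)|
      + |g x - condMean ν h x|) := by
    filter_upwards [ae_isRecurrent (ℓ := ℓ) hν hF hFm] with x hx
    have hgj : ∀ j ∈ Finset.Icc 1 J, (g - condMean ν h) ((pastReturn F ℓ)^[j] x)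
        = g x - condMean ν h ((pastReturn F ℓ)^[j] x) := fun j _ => by
      rw [Pi.sub_apply, hlabel _ _ (pastLabel_pastReturn_iterate hx j)]
    rw [Finset.sum_congr rfl hgj, Finset.sum_sub_distrib, Finset.sum_sub_distrib, mul_sub, mul_sub]
    simp only [Finset.sum_const, Nat.card_Icc, add_tsub_cancel_right, nsmul_eq_mul,
      inv_mul_cancel_left₀ hJ', returnAverage]
    set a := (J : ℝ)⁻¹ * ∑ j ∈ Finset.Icc 1 J, h ((pastReturn F ℓ)^[j] x 0)
    set b := (J : ℝ)⁻¹ * ∑ j ∈ Finset.Icc 1 J, condMean ν h ((pastReturn F ℓ)^[j] x)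
    -- `a - b` is the orthogonal average. Since `g` is constant along the returns, `g x - b` is the
    -- average of `g - condMean ν h`; it and the last term each cost `∫ |g - condMean ν h|`, whence
    -- the factor 2.
    have e : a - condMean ν h x = (a - b) + (-(g x - b) + (g x - condMean ν h x)) := by ring
    rw [e]
    refine (abs_add_le _ _).trans (add_le_add le_rfl ((abs_add_le _ _).trans ?_))
    rw [abs_neg]
  calc _ ≤ _ := integral_mono_of_nonneg (ae_of_all _ fun _ => abs_nonneg _)
        ((hint hdi).add ((hint (hg.sub hcm)).add (hg.sub hcm).abs)) hpt
    _ = _ := (integral_add (hint hdi) ((hint (hg.sub hcm)).add (hg.sub hcm).abs)).trans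
        (congrArg _ (integral_add (hint (hg.sub hcm)) (hg.sub hcm).abs))
    _ ≤ _ := add_le_add h1 (add_le_add h2 le_rfl)
    _ = _ := by simp only [Pi.sub_apply]; ring

end ConditionalLaw

/-! ### Quantized pasts as a filtration increasing to the full past. -/

section QuantizedPast

/-- The σ-algebra generated by the quantized `ℓ`-past. -/
abbrev labelSigma (F : Set (Set ℝ)) (ℓ : ℕ) : MeasurableSpace (ℤ → ℝ) :=
  MeasurableSpace.generateFrom
    {s | ∃ i ∈ Finset.Icc 1 ℓ, ∃ A ∈ F, (fun x : ℤ → ℝ => x (-(i : ℤ))) ⁻¹' A = s}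

theorem labelSigma_mono {F G : Set (Set ℝ)} {ℓ m : ℕ} (hFG : F ⊆ G) (hℓm : ℓ ≤ m) :
    labelSigma F ℓ ≤ labelSigma G m := by
  refine MeasurableSpace.generateFrom_mono ?_
  rintro _ ⟨i, hi, A, hA, rfl⟩
  rw [Finset.mem_Icc] at hi
  exact ⟨i, Finset.mem_Icc.2 ⟨hi.1, hi.2.trans hℓm⟩, A, hFG hA, rfl⟩

theorem labelSigma_le_pastSigma {F : Set (Set ℝ)} {ℓ : ℕ} (hFm : ∀ s ∈ F, MeasurableSet s) :
    labelSigma F ℓ ≤ pastSigma := by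
  refine MeasurableSpace.generateFrom_le ?_
  rintro _ ⟨i, hi, A, hA, rfl⟩
  obtain ⟨j, rfl⟩ := Nat.exists_eq_add_of_le' (Finset.mem_Icc.1 hi).1
  push_cast
  exact measurable_pastSigma_apply j (hFm A hA)

theorem mem_iff_of_pastLabel_eq {F : Set (Set ℝ)} {ℓ : ℕ} {s : Set (ℤ → ℝ)}
    (hs : MeasurableSet[labelSigma F ℓ] s) {x y : ℤ → ℝ}
    (hxy : pastLabel F ℓ x = pastLabel F ℓ y) : x ∈ s ↔ y ∈ s := by
  rw [pastLabel_eq_iff] at hxy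
  induction s, hs using MeasurableSpace.generateFrom_induction with
  | hC t ht _ =>
    obtain ⟨i, hi, A, hA, rfl⟩ := ht
    exact quantize_eq_iff.1 (hxy i hi) A hA
  | empty => simp
  | compl t _ ih => exact not_congr ih
  | iUnion f _ ih => simpa using exists_congr ih

/-- Lets the conditional expectation given `labelSigma` play the role of `g`: its chosen version
depends on the label at every path, not merely almost surely. -/
theorem eq_of_pastLabel_eq {F : Set (Set ℝ)} {ℓ : ℕ} {g : (ℤ → ℝ) → ℝ}
    (hg : Measurable[labelSigma F ℓ] g) {x y : ℤ → ℝ}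
    (hxy : pastLabel F ℓ x = pastLabel F ℓ y) : g x = g y :=
  ((mem_iff_of_pastLabel_eq (hg (measurableSet_singleton (g x))) hxy).1 rfl).symm

variable {B : ℕ → Set (Set ℝ)} {ℓ : ℕ → ℕ}

/-- The filtration generated by the quantized pasts. -/
def labelFiltration (hBm : ∀ k, ∀ s ∈ B k, MeasurableSet s) (hB : Monotone B) (hℓ : Monotone ℓ) :
    Filtration ℕ (inferInstance : MeasurableSpace (ℤ → ℝ)) where
  seq k := labelSigma (B k) (ℓ k)
  mono' _ _ h := labelSigma_mono (hB h) (hℓ h)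
  le' k := (labelSigma_le_pastSigma (hBm k)).trans pastSigma_le

theorem iSup_labelSigma (hBm : ∀ k, ∀ s ∈ B k, MeasurableSet s) (hB : Monotone B)
    (hBgen : MeasurableSpace.generateFrom (⋃ k, B k) = borel ℝ) (hℓ : Tendsto ℓ atTop atTop) :
    ⨆ k, labelSigma (B k) (ℓ k) = pastSigma := by
  refine le_antisymm (iSup_le fun k => labelSigma_le_pastSigma (hBm k)) ?_
  have hgen : Real.measurableSpace = MeasurableSpace.generateFrom (⋃ k, B k) := by
    rw [hBgen]; exact BorelSpace.measurable_eq
  rw [pastSigma, MeasurableSpace.pi, MeasurableSpace.comap_iSup]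
  refine iSup_le fun i => ?_
  rw [MeasurableSpace.comap_comp, hgen, MeasurableSpace.comap_generateFrom]
  refine MeasurableSpace.generateFrom_le ?_
  rintro _ ⟨A, hA, rfl⟩
  obtain ⟨k, hk⟩ := Set.mem_iUnion.1 hA
  obtain ⟨m, hm⟩ := (hℓ.eventually_ge_atTop (i + 1)).exists_forall_of_atTop
  -- Level `max k m` is fine enough to contain `A` and its block reaches back to time `-(i + 1)`.
  have hkm : k ≤ max k m := le_max_left k m
  replace hm : i + 1 ≤ ℓ (max k m) := hm _ (le_max_right k m)
  refine (le_iSup (fun k => labelSigma (B k) (ℓ k)) (max k m)) _ ?_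
  refine MeasurableSpace.measurableSet_generateFrom
    ⟨i + 1, Finset.mem_Icc.2 ⟨by omega, hm⟩, A, hB hkm hk, ?_⟩
  ext x
  simp [past]

/-- Lévy's upward theorem in `L¹` for `labelFiltration`, whose supremum is `pastSigma`. -/
theorem tendsto_integral_abs_condExp_sub_condMean (ν : Measure (ℤ → ℝ)) [IsProbabilityMeasure ν]
    (hBm : ∀ k, ∀ s ∈ B k, MeasurableSet s) (hB : Monotone B)
    (hBgen : MeasurableSpace.generateFrom (⋃ k, B k) = borel ℝ)
    (hℓmono : Monotone ℓ) (hℓ : Tendsto ℓ atTop atTop)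
    {h : ℝ → ℝ} (hh : Measurable h) {M : ℝ} (hM : ∀ y, |h y| ≤ M) :
    Tendsto (fun k => ∫ x, |(ν[fun x => h (x 0) | labelSigma (B k) (ℓ k)]) x
      - condMean ν h x| ∂ν) atTop (𝓝 0) := by
  have hcm : Integrable (condMean ν h) ν :=
    integrable_of_bounded (measurable_condMean hh) (abs_condMean_le hM)
  have hlim := tendsto_eLpNorm_condExp (μ := ν) (ℱ := labelFiltration hBm hB hℓmono)
    fun x => h (x 0)
  have hsup : ⨆ k, labelFiltration hBm hB hℓmono k = pastSigma :=
    iSup_labelSigma hBm hB hBgen hℓ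
  rw [hsup] at hlim
  refine ((ENNReal.tendsto_toReal ENNReal.zero_ne_top).comp hlim).congr fun k => ?_
  have hint : Integrable (fun x => (ν[fun x => h (x 0) | labelSigma (B k) (ℓ k)]) x
      - condMean ν h x) ν := integrable_condExp.sub hcm
  rw [Function.comp_apply, eLpNorm_congr_ae (g := fun x =>
      (ν[fun x => h (x 0) | labelSigma (B k) (ℓ k)]) x - condMean ν h x),
    eLpNorm_one_eq_lintegral_enorm, ← ofReal_integral_norm_eq_lintegral_enorm hint,
    ENNReal.toReal_ofReal (integral_nonneg fun _ => norm_nonneg _)]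
  · rfl
  · filter_upwards [condExp_ae_eq_condMean (ν := ν) hh hM] with x hx
    rw [Pi.sub_apply, hx]
    rfl

end QuantizedPast

/-! ### Convergence in `L¹` and the cost of truncation. -/

section Convergence

theorem tendstoInL1_of_bounded {Ω : Type*} [MeasurableSpace Ω] {μ : Measure Ω} [IsFiniteMeasure μ]
    {f : ℕ → Ω → ℝ} {g : Ω → ℝ} {C : ℝ} (hf : ∀ n, AEStronglyMeasurable (f n) μ)
    (hfC : ∀ n, ∀ᵐ x ∂μ, |f n x| ≤ C) (hg : Integrable g μ)
    (hlim : Tendsto (fun n => ∫ x, |f n x - g x| ∂μ) atTop (𝓝 0)) : TendstoInL1 μ f g := by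
  have hfi (n : ℕ) : Integrable (f n) μ := Integrable.of_bound (hf n) C (hfC n)
  refine ⟨fun n => memLp_one_iff_integrable.2 (hfi n), memLp_one_iff_integrable.2 hg, ?_⟩
  have h0 := ENNReal.tendsto_ofReal hlim
  rw [ENNReal.ofReal_zero] at h0
  refine h0.congr fun n => ?_
  rw [eLpNorm_one_eq_lintegral_enorm, ← ofReal_integral_norm_eq_lintegral_enorm
    (show Integrable (fun x => f n x - g x) μ from (hfi n).sub hg)]
  rfl

theorem TendstoInL1.comp_measurePreserving {Ω Ω' : Type*} [MeasurableSpace Ω] [MeasurableSpace Ω']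
    {μ : Measure Ω} {ν : Measure Ω'} {Φ : Ω → Ω'} (hΦ : MeasurePreserving Φ μ ν)
    {f : ℕ → Ω' → ℝ} {g : Ω' → ℝ} (h : TendstoInL1 ν f g) :
    TendstoInL1 μ (fun n ω => f n (Φ ω)) (fun ω => g (Φ ω)) := by
  obtain ⟨hf, hg, hlim⟩ := h
  refine ⟨fun n => (hf n).comp_measurePreserving hΦ, hg.comp_measurePreserving hΦ, ?_⟩
  refine hlim.congr fun n => ?_
  exact (eLpNorm_comp_measurePreserving ((hf n).1.sub hg.1) hΦ).symm

variable {ν : Measure (ℤ → ℝ)} [IsProbabilityMeasure ν] {F : Set (Set ℝ)} {ℓ : ℕ}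

open Classical in
/-- The truncated average along returns, with default value `q`. -/
noncomputable def truncatedAverage (F : Set (Set ℝ)) (ℓ J n : ℕ) (h : ℝ → ℝ) (q : ℝ)
    (x : ℤ → ℝ) : ℝ :=
  if ℓ + returnSum F ℓ J x ≤ n then returnAverage F ℓ J (fun x => h (x 0)) x else q

variable {h : ℝ → ℝ} {M : ℝ}

theorem abs_returnAverage_le (hM : ∀ y, |h y| ≤ M) {J : ℕ} (hJ : 0 < J) (x : ℤ → ℝ) :
    |returnAverage F ℓ J (fun x => h (x 0)) x| ≤ M := by
  have hJ' : (0 : ℝ) < J := by exact_mod_cast hJ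
  rw [returnAverage, abs_mul, abs_inv, Nat.abs_cast, inv_mul_le_iff₀ hJ']
  refine (Finset.abs_sum_le_sum_abs _ _).trans ((Finset.sum_le_sum fun j _ => hM _).trans ?_)
  simp

theorem measurable_returnAverage (hS : Measurable (pastReturn F ℓ)) (hh : Measurable h) (J : ℕ) :
    Measurable (returnAverage F ℓ J fun x => h (x 0)) :=
  (Finset.measurable_sum _ fun j _ =>
    (hh.comp (measurable_pi_apply 0)).comp (hS.iterate j)).const_mul _

theorem measurable_truncatedAverage (hF : F.Finite) (hFm : ∀ s ∈ F, MeasurableSet s)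
    (hS : Measurable (pastReturn F ℓ)) (hh : Measurable h) (J n : ℕ) (q : ℝ) :
    Measurable (truncatedAverage F ℓ J n h q) :=
  Measurable.ite (measurableSet_le ((measurable_returnSum hF hFm hS J).const_add ℓ)
    measurable_const) (measurable_returnAverage hS hh J) measurable_const

theorem integral_abs_truncatedAverage_sub_le (hν : MeasurePreserving shiftBack ν ν)
    (hF : F.Finite) (hFm : ∀ s ∈ F, MeasurableSet s) (hh : Measurable h) (hM : ∀ y, |h y| ≤ M)
    {J : ℕ} (hJ : 0 < J) (n : ℕ) (q : ℝ) :
    ∫ x, |truncatedAverage F ℓ J n h q x - condMean ν h x| ∂ν ≤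
      ∫ x, |returnAverage F ℓ J (fun x => h (x 0)) x - condMean ν h x| ∂ν
        + (|q| + M) * ν.real {x | n < ℓ + returnSum F ℓ J x} := by
  have hS := (measurePreserving_pastReturn (ℓ := ℓ) hν hF hFm).measurable
  have hset : MeasurableSet {x | n < ℓ + returnSum F ℓ J x} :=
    measurableSet_lt measurable_const ((measurable_returnSum hF hFm hS J).const_add ℓ)
  have h1 : Integrable
      (fun x => |returnAverage F ℓ J (fun x => h (x 0)) x - condMean ν h x|) ν :=
    ((integrable_of_bounded (measurable_returnAverage hS hh J) (abs_returnAverage_le hM hJ)).sub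
      (integrable_of_bounded (measurable_condMean hh) (abs_condMean_le hM))).abs
  have h2 : Integrable ({x | n < ℓ + returnSum F ℓ J x}.indicator fun _ => |q| + M) ν :=
    (integrable_const _).indicator hset
  calc _ ≤ ∫ x, (|returnAverage F ℓ J (fun x => h (x 0)) x - condMean ν h x|
        + {x | n < ℓ + returnSum F ℓ J x}.indicator (fun _ => |q| + M) x) ∂ν := by
        refine integral_mono_of_nonneg (ae_of_all _ fun _ => abs_nonneg _) (h1.add h2)
          (ae_of_all _ fun x => ?_)
        simp only [truncatedAverage]
        split_ifs with hx
        · rw [Set.indicator_of_notMem (by simpa using hx), add_zero]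
        · rw [Set.indicator_of_mem (by simpa using hx)]
          exact ((abs_sub _ _).trans (add_le_add le_rfl (abs_condMean_le hM x))).trans
            (le_add_of_nonneg_left (abs_nonneg _))
    _ = _ := by
        rw [integral_add h1 h2, integral_indicator_const _ hset, smul_eq_mul, mul_comm (ν.real _)]

end Convergence

/-! ### Consistency on path space. -/

section Consistency

variable {ν : Measure (ℤ → ℝ)} [IsProbabilityMeasure ν] {B : ℕ → Set (Set ℝ)} {ℓ J kn : ℕ → ℕ}
  {ε : ℕ → ℝ}

theorem tendsto_measureReal_lt_returnSum (hν : MeasurePreserving shiftBack ν ν)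
    (hBfin : ∀ k, (B k).Finite) (hBm : ∀ k, ∀ s ∈ B k, MeasurableSet s)
    (hJpos : ∀ k, 0 < J k) (hk : Tendsto kn atTop atTop) (hεpos : ∀ k, 0 < ε k)
    (hε : Tendsto ε atTop (𝓝 0))
    (hgrowth : ∀ᶠ n : ℕ in atTop,
      (ℓ (kn n) : ℝ) + (J (kn n) : ℝ) * ((atoms (B (kn n))).ncard : ℝ) ^ ℓ (kn n) / ε (kn n)
        ≤ (n : ℝ)) :
    Tendsto (fun n => ν.real {x | n < ℓ (kn n) + returnSum (B (kn n)) (ℓ (kn n)) (J (kn n)) x})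
      atTop (𝓝 0) :=
  squeeze_zero' (Eventually.of_forall fun _ => measureReal_nonneg)
    (hgrowth.mono fun _ hn =>
      measureReal_lt_returnSum_le hν (hBfin _) (hBm _) (hJpos _) (hεpos _) hn)
    (hε.comp hk)

theorem tendsto_measure_searchDepth_le (hν : MeasurePreserving shiftBack ν ν)
    (hBfin : ∀ k, (B k).Finite) (hBm : ∀ k, ∀ s ∈ B k, MeasurableSet s)
    (hlim : Tendsto
      (fun n => ν.real {x | n < ℓ (kn n) + returnSum (B (kn n)) (ℓ (kn n)) (J (kn n)) x})
      atTop (𝓝 0))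
    {Ω : Type*} [MeasurableSpace Ω] {μ : Measure Ω} {Φ : Ω → ℤ → ℝ}
    (hΦ : MeasurePreserving Φ μ ν) :
    Tendsto (fun n : ℕ => μ {ω | searchDepth (B (kn n)) (ℓ (kn n)) (J (kn n)) (Φ ω) ≤ (n : ℕ∞)})
      atTop (𝓝 1) := by
  have h0 := ENNReal.tendsto_ofReal (hlim.const_sub 1)
  rw [sub_zero, ENNReal.ofReal_one] at h0
  refine h0.congr fun n => ?_
  have hS := (measurePreserving_pastReturn (ℓ := ℓ (kn n)) hν (hBfin (kn n)) (hBm _)).measurable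
  have hset : MeasurableSet
      {x | n < ℓ (kn n) + returnSum (B (kn n)) (ℓ (kn n)) (J (kn n)) x} :=
    measurableSet_lt measurable_const
      ((measurable_returnSum (hBfin _) (hBm _) hS _).const_add (ℓ (kn n)))
  rw [← probReal_compl_eq_one_sub hset, ofReal_measureReal, ← hΦ.measure_preimage
    hset.compl.nullMeasurableSet]
  refine measure_congr ?_
  filter_upwards [hΦ.quasiMeasurePreserving.ae
    (ae_isRecurrent (ℓ := ℓ (kn n)) hν (hBfin (kn n)) (hBm _))] with ω hω
  have hiff : ¬ n < ℓ (kn n) + returnSum (B (kn n)) (ℓ (kn n)) (J (kn n)) (Φ ω) ↔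
      searchDepth (B (kn n)) (ℓ (kn n)) (J (kn n)) (Φ ω) ≤ (n : ℕ∞) := by
    rw [searchDepth_eq hω, Nat.cast_le, not_lt]
  exact propext hiff

theorem tendstoInL1_integral_truncated (hν : MeasurePreserving shiftBack ν ν)
    (hBfin : ∀ k, (B k).Finite) (hBm : ∀ k, ∀ s ∈ B k, MeasurableSet s) (hB : Monotone B)
    (hBgen : MeasurableSpace.generateFrom (⋃ k, B k) = borel ℝ)
    (hℓmono : Monotone ℓ) (hℓ : Tendsto ℓ atTop atTop)
    (hJpos : ∀ k, 0 < J k) (hJ : Tendsto J atTop atTop) (hk : Tendsto kn atTop atTop)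
    (hlim : Tendsto
      (fun n => ν.real {x | n < ℓ (kn n) + returnSum (B (kn n)) (ℓ (kn n)) (J (kn n)) x})
      atTop (𝓝 0)) (Q : Measure ℝ) {h : ℝ → ℝ} (hh : Measurable h) {M : ℝ}
    (hM : ∀ y, |h y| ≤ M) :
    TendstoInL1 ν
      (fun n x => ∫ y, h y ∂(truncated (B (kn n)) (ℓ (kn n)) (J (kn n)) Q n x))
      (condMean ν h) := by
  set q := ∫ y, h y ∂Q
  have hae (n : ℕ) : (fun x => ∫ y, h y ∂(truncated (B (kn n)) (ℓ (kn n)) (J (kn n)) Q n x))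
      =ᵐ[ν] truncatedAverage (B (kn n)) (ℓ (kn n)) (J (kn n)) n h q := by
    filter_upwards [ae_isRecurrent (ℓ := ℓ (kn n)) hν (hBfin (kn n)) (hBm _)] with x hx
    exact integral_truncated hx _ _ _ hh
  have hmeas (n : ℕ) : Measurable (truncatedAverage (B (kn n)) (ℓ (kn n)) (J (kn n)) n h q) :=
    measurable_truncatedAverage (hBfin _) (hBm _)
      (measurePreserving_pastReturn hν (hBfin _) (hBm _)).measurable hh _ _ _
  refine tendstoInL1_of_bounded (C := max M |q|)
    (fun n => (hmeas n).aestronglyMeasurable.congr (hae n).symm) (fun n => ?_)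
    (integrable_of_bounded (measurable_condMean hh) (abs_condMean_le hM)) ?_
  · filter_upwards [hae n] with x hx
    rw [hx, truncatedAverage]
    split_ifs
    · exact (abs_returnAverage_le hM (hJpos _) x).trans (le_max_left _ _)
    · exact le_max_right _ _
  -- Three errors: fluctuation of order `1/√J`, approximation of the conditional mean by the
  -- quantized past, and truncation.
  · have hbound (n : ℕ) :
        ∫ x, |∫ y, h y ∂(truncated (B (kn n)) (ℓ (kn n)) (J (kn n)) Q n x)
          - condMean ν h x| ∂ν ≤
        (((2 * M) ^ 2 + 1) / (2 * √(J (kn n) : ℝ))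
          + 2 * ∫ x, |(ν[fun x => h (x 0) | labelSigma (B (kn n)) (ℓ (kn n))]) x
            - condMean ν h x| ∂ν)
          + (|q| + M)
            * ν.real {x | n < ℓ (kn n) + returnSum (B (kn n)) (ℓ (kn n)) (J (kn n)) x} := by
      rw [integral_congr_ae ((hae n).mono fun x hx => congrArg (fun r => |r - condMean ν h x|) hx)]
      refine (integral_abs_truncatedAverage_sub_le hν (hBfin _) (hBm _) hh hM (hJpos _) n q).trans
        (add_le_add ?_ le_rfl)
      exact integral_abs_returnAverage_sub_le hν (hBfin _) (hBm _) hh hM (hJpos _)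
        integrable_condExp fun x y =>
          eq_of_pastLabel_eq stronglyMeasurable_condExp.measurable
    have hsqrt : Tendsto (fun n => ((2 * M) ^ 2 + 1) / (2 * √(J (kn n) : ℝ))) atTop (𝓝 0) := by
      refine Tendsto.const_div_atTop (Tendsto.const_mul_atTop two_pos ?_) _
      exact Real.tendsto_sqrt_atTop.comp (tendsto_natCast_atTop_atTop.comp (hJ.comp hk))
    have hcond := (tendsto_integral_abs_condExp_sub_condMean ν hBm hB hBgen hℓmono hℓ hh hM).comp hk
    refine squeeze_zero (fun n => integral_nonneg fun _ => abs_nonneg _) hbound ?_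
    have := (hsqrt.add (hcond.const_mul 2)).add (hlim.const_mul (|q| + M))
    simpa using this

end Consistency

/-! ### Transfer from path space to the original probability space. -/

section Transfer

variable {Ω : Type*} [MeasurableSpace Ω] {μ : Measure Ω} {X : ℤ → Ω → ℝ}

theorem measurePreserving_shiftBack (hX : ∀ t, Measurable (X t)) (hstat : IsStationary μ X) :
    MeasurePreserving shiftBack (μ.map fun ω t => X t ω) (μ.map fun ω t => X t ω) := by
  have hm : Measurable shiftBack := measurable_pi_iff.2 fun t => measurable_pi_apply _
  refine ⟨hm, ?_⟩
  conv_lhs => rw [← hstat]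
  rw [Measure.map_map hm (measurable_pi_iff.2 fun t => hX (t + 1))]
  congr 1
  ext ω t
  simp [shiftBack]

/-- `condDistrib` is built from the joint law of past and present, which is the same on both spaces;
hence equality at every `ω`, with no exceptional null set. -/
theorem condLaw_map [IsFiniteMeasure μ] (hX : ∀ t, Measurable (X t)) (ω : Ω) :
    condLaw μ X ω = condLaw (μ.map fun ω t => X t ω) (fun t (x : ℤ → ℝ) => x t)
      (fun t => X t ω) := by
  have hker {ρ ρ' : Measure ((ℕ → ℝ) × ℝ)} [IsFiniteMeasure ρ] [IsFiniteMeasure ρ']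
      (h : ρ = ρ') : ρ.condKernel = ρ'.condKernel := by subst h; rfl
  have hmap : μ.map (fun ω => (past X ω, X 0 ω)) =
      (μ.map fun ω t => X t ω).map
        fun x : ℤ → ℝ => (past (fun t (x : ℤ → ℝ) => x t) x, x 0) := by
    rw [Measure.map_map (measurable_past.prodMk (measurable_pi_apply 0)) (measurable_pi_iff.2 hX)]
    rfl
  unfold condLaw
  rw [condDistrib, condDistrib]
  exact congrArg (fun κ => κ (past X ω)) (hker hmap)

end Transfer

end RecurrenceEstimate

theorem theorem4 {Ω : Type*} [MeasurableSpace Ω] (μ : Measure Ω) [IsProbabilityMeasure μ]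
    -- a real-valued stationary process
    (X : ℤ → Ω → ℝ) (hX : ∀ t, Measurable (X t)) (hstat : RecurrenceEstimate.IsStationary μ X)
    -- an increasing sequence of finite fields that generates the Borel sigma-field
    (B : ℕ → Set (Set ℝ)) (hBfield : ∀ k, IsSetAlgebra (B k)) (hBfin : ∀ k, (B k).Finite)
    (hBmono : Monotone B) (hBgen : MeasurableSpace.generateFrom (⋃ k, B k) = borel ℝ)
    -- block lengths and sample sizes
    (ℓ J : ℕ → ℕ)
    (hℓpos : ∀ k, 0 < ℓ k) (hℓmono : Monotone ℓ) (hℓ : Tendsto ℓ atTop atTop)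
    (hJpos : ∀ k, 0 < J k) (hJmono : Monotone J) (hJ : Tendsto J atTop atTop)
    -- the default measure
    (Q : Measure ℝ) [IsFiniteMeasure Q]
    -- the truncation scheme
    (kn : ℕ → ℕ) (hkmono : Monotone kn) (hk : Tendsto kn atTop atTop)
    (ε : ℕ → ℝ) (hεpos : ∀ k, 0 < ε k) (hε : Tendsto ε atTop (𝓝 0))
    (hgrowth : ∀ᶠ n : ℕ in atTop,
      (ℓ (kn n) : ℝ) + (J (kn n) : ℝ) *
        ((RecurrenceEstimate.atoms (B (kn n))).ncard : ℝ) ^ ℓ (kn n) / ε (kn n) ≤ (n : ℝ)) :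
    Tendsto (fun n : ℕ => μ {ω | RecurrenceEstimate.searchDepth (B (kn n)) (ℓ (kn n)) (J (kn n))
        (fun t => X t ω) ≤ (n : ℕ∞)}) atTop (𝓝 1) ∧
    (∀ A ∈ ⋃ k, B k,
      RecurrenceEstimate.TendstoInL1 μ
        (fun n ω => (RecurrenceEstimate.truncated (B (kn n)) (ℓ (kn n)) (J (kn n)) Q n
          (fun t => X t ω)).real A)
        (fun ω => (RecurrenceEstimate.condLaw μ X ω).real A)) ∧
    (∀ h : ℝ → ℝ, Continuous h → (∃ M : ℝ, ∀ x, |h x| ≤ M) →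
      RecurrenceEstimate.TendstoInL1 μ
        (fun n ω => ∫ x, h x ∂(RecurrenceEstimate.truncated (B (kn n)) (ℓ (kn n)) (J (kn n)) Q n
          (fun t => X t ω)))
        (fun ω => ∫ x, h x ∂(RecurrenceEstimate.condLaw μ X ω))) := by
  have hBm : ∀ k, ∀ s ∈ B k, MeasurableSet s := fun k s hs => by
    rw [BorelSpace.measurable_eq (α := ℝ), ← hBgen]
    exact MeasurableSpace.measurableSet_generateFrom (Set.mem_iUnion.2 ⟨k, hs⟩)
  have hΦm : Measurable fun ω (t : ℤ) => X t ω := measurable_pi_iff.2 hX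
  have hΦ : MeasurePreserving (fun ω (t : ℤ) => X t ω) μ (μ.map fun ω t => X t ω) :=
    hΦm.measurePreserving μ
  have : IsProbabilityMeasure (μ.map fun ω t => X t ω) :=
    Measure.isProbabilityMeasure_map hΦm.aemeasurable
  have hν := RecurrenceEstimate.measurePreserving_shiftBack hX hstat
  have hlim := RecurrenceEstimate.tendsto_measureReal_lt_returnSum hν hBfin hBm hJpos hk hεpos hε
    hgrowth
  -- Both consistency claims are instances for a bounded measurable `h`: an indicator with `M = 1`,
  -- or a bounded continuous function.
  have main {h : ℝ → ℝ} (hh : Measurable h) {M : ℝ} (hM : ∀ y, |h y| ≤ M) :=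
    (RecurrenceEstimate.tendstoInL1_integral_truncated hν hBfin hBm hBmono hBgen hℓmono hℓ hJpos hJ
      hk hlim Q hh hM).comp_measurePreserving hΦ
  refine ⟨RecurrenceEstimate.tendsto_measure_searchDepth_le hν hBfin hBm hlim hΦ, fun A hA => ?_,
    fun h hc ⟨M, hM⟩ => ?_⟩
  · obtain ⟨k, hk⟩ := Set.mem_iUnion.1 hA
    have hAm := hBm k A hk
    have := main (h := A.indicator 1) (M := 1) (measurable_one.indicator hAm) fun y => by
      by_cases hy : y ∈ A <;> simp [hy]
    simpa only [RecurrenceEstimate.condMean, ← RecurrenceEstimate.condLaw_map hX,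
      integral_indicator_one hAm] using this
  · simpa only [RecurrenceEstimate.condMean, ← RecurrenceEstimate.condLaw_map hX] using
      main hc.measurable hM
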